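/- Let two nested cubes in $\mathbb{R}^3$ have a common center and parallel edges, the outer one with edge $a>0$ and the inner one with edge $ta$, where $0<t<1$. Place a mass $\mu_1$ at each vertex of the outer cube and a mass $\mu_2$ at each vertex of the inner cube; here $\mu_1,\mu_2$ are positive or, more generally, real numbers with $\mu_2\neq 0$ and $\mu_1+\mu_2\neq 0$. A configuration $q_1,\dots,q_N\in\mathbb{R}^3$ with masses $m_1,\dots,m_N$ and center of mass $q_0$ is called central if there is $\lambda\in\mathbb{R}$ with $-\lambda(q_i-q_0)=\sum_{j\ne i} m_j\frac{q_j-q_i}{|q_j-q_i|^3}$ for all $i$. Put $$\gamma_1(t)=-\Big((2\sqrt3+9\sqrt2+18)t-\tfrac{72(t^2+6t+1)}{(3t^2+2t+3)^{3/2}}+\tfrac{72(t^2-6t+1)}{(3t^2-2t+3)^{3/2}}-\tfrac{8\sqrt3}{t+1}-\tfrac{8\sqrt3}{t-1}+\tfrac{2\sqrt3+9\sqrt2+18}{t^2}\Big),$$ $$\begin{aligned}\gamma_0(t)=&-\tfrac{9(3t+1)(t+3)}{(3t^2+2t+3)^3}+\tfrac{9(3t-1)(t-3)}{(3t^2-2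t+3)^3}+\tfrac{6\sqrt3\sqrt2+12\sqrt3+54\sqrt2+83}{96t^2}\\&-\tfrac{4\sqrt3}{(3t^2+2t+3)^{3/2}(t+1)}-\tfrac{2\sqrt3}{(3t^2-2t+3)^{3/2}(t+1)}-\tfrac{2\sqrt3}{(3t^2+2t+3)^{3/2}(t-1)}-\tfrac{4\sqrt3}{(3t^2-2t+3)^{3/2}(t-1)}\\&-\tfrac{144t}{(3t^2+2t+3)^{3/2}(3t^2-2t+3)^{3/2}}-\tfrac1{3(t+1)^4}+\tfrac1{3(t-1)^4},\end{aligned}$$ and $c(t)=-\gamma_0(t)/\gamma_1(t)$. Then $\gamma_1(t)<0$, $\gamma_0(t)>0$ (so $c(t)>0$) and $24c(t)-\tfrac1{12}\sqrt3-\tfrac38\sqrt2-\tfrac34>0$, and the configuration of the sixteen vertices is central if and only if $$\frac{\mu_1}{\mu_2}=-\frac{24c(t)-\frac{\sqrt3t+\sqrt3}{3(t+1)^3}-\frac{3(t+3)}{(3t^2+2t+3)^{3/2}}+\frac{3(t-3)}{(3t^2-2t+3)^{3/2}}-\frac{\sqrt3t-\sqrt3}{3(t-1)^3}}{24c(t)-\frac1{12}\sqrt3-\frac38\sqrt2-\frac34}.$$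 -/

import Mathlib

open Real

noncomputable section

/-- Center of mass `(∑ mⱼ qⱼ) / (∑ mⱼ)` of finitely many point masses (meaningful when the total
mass is nonzero). -/
def centerOfMass {ι E : Type*} [Fintype ι] [NormedAddCommGroup E] [NormedSpace ℝ E]
    (m : ι → ℝ) (q : ι → E) : E :=
  (∑ j, m j)⁻¹ • ∑ j, m j • q j

/-- The configuration `q` with masses `m` is central for the Newtonian N-body problem: for some
real `lam`, every body satisfies
`-lam (qᵢ - q₀) = ∑_{j ≠ i} mⱼ (qⱼ - qᵢ) / |qⱼ - qᵢ|³`, with `q₀` the center of mass. -/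
def IsCentralConfiguration {ι E : Type*} [Fintype ι] [DecidableEq ι]
    [NormedAddCommGroup E] [NormedSpace ℝ E] (m : ι → ℝ) (q : ι → E) : Prop :=
  ∃ lam : ℝ, ∀ i, -lam • (q i - centerOfMass m q) =
    ∑ j ∈ Finset.univ.erase i, (m j / ‖q j - q i‖ ^ 3) • (q j - q i)

/-- Labels of the eight vertices of a cube: a choice of sign for each of the three axes. -/
abbrev CubeLabel : Type := Fin 3 → Bool

/-- The vertex with label `s` of the cube with center `o`, edge length `a`, and edges parallel to
the orthonormal frame `e`. -/
def cubeVertex (o : EuclideanSpace ℝ (Fin 3))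
    (e : OrthonormalBasis (Fin 3) ℝ (EuclideanSpace ℝ (Fin 3))) (a : ℝ) (s : CubeLabel) :
    EuclideanSpace ℝ (Fin 3) :=
  o + ∑ k, (if s k then a / 2 else -(a / 2)) • e k

/-- The sixteen vertices of two homothetic nested cubes with common center `o` and frame `e`:
the outer cube (left summand) has edge `a`, the inner cube (right summand) has edge `t * a`. -/
def nestedCubes (o : EuclideanSpace ℝ (Fin 3))
    (e : OrthonormalBasis (Fin 3) ℝ (EuclideanSpace ℝ (Fin 3))) (a t : ℝ) :
    CubeLabel ⊕ CubeLabel → EuclideanSpace ℝ (Fin 3) :=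
  Sum.elim (cubeVertex o e a) (cubeVertex o e (t * a))

/-- Masses that are equal on each cube: `μ₁` on the outer cube and `μ₂` on the inner cube. -/
def nestedCubesMass (μ₁ μ₂ : ℝ) : CubeLabel ⊕ CubeLabel → ℝ :=
  Sum.elim (fun _ => μ₁) (fun _ => μ₂)

def cubeGamma₁ (t : ℝ) : ℝ :=
  -((2 * √3 + 9 * √2 + 18) * t
    - 72 * (t ^ 2 + 6 * t + 1) / (3 * t ^ 2 + 2 * t + 3) ^ (3 / 2 : ℝ)
    + 72 * (t ^ 2 - 6 * t + 1) / (3 * t ^ 2 - 2 * t + 3) ^ (3 / 2 : ℝ)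
    - 8 * √3 / (t + 1) - 8 * √3 / (t - 1)
    + (2 * √3 + 9 * √2 + 18) / t ^ 2)

def cubeGamma₀ (t : ℝ) : ℝ :=
  -(9 * (3 * t + 1) * (t + 3) / (3 * t ^ 2 + 2 * t + 3) ^ 3)
    + 9 * (3 * t - 1) * (t - 3) / (3 * t ^ 2 - 2 * t + 3) ^ 3
    + (6 * √3 * √2 + 12 * √3 + 54 * √2 + 83) / (96 * t ^ 2)
    - 4 * √3 / ((3 * t ^ 2 + 2 * t + 3) ^ (3 / 2 : ℝ) * (t + 1))
    - 2 * √3 / ((3 * t ^ 2 - 2 * t + 3) ^ (3 / 2 : ℝ) * (t + 1))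
    - 2 * √3 / ((3 * t ^ 2 + 2 * t + 3) ^ (3 / 2 : ℝ) * (t - 1))
    - 4 * √3 / ((3 * t ^ 2 - 2 * t + 3) ^ (3 / 2 : ℝ) * (t - 1))
    - 144 * t / ((3 * t ^ 2 + 2 * t + 3) ^ (3 / 2 : ℝ) * (3 * t ^ 2 - 2 * t + 3) ^ (3 / 2 : ℝ))
    - 1 / (3 * (t + 1) ^ 4) + 1 / (3 * (t - 1) ^ 4)

def cubeC (t : ℝ) : ℝ := -cubeGamma₀ t / cubeGamma₁ t

/-- Numerator in the formula for the mass ratio. -/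
def cubeRatioNum (t : ℝ) : ℝ :=
  24 * cubeC t - (√3 * t + √3) / (3 * (t + 1) ^ 3)
    - 3 * (t + 3) / (3 * t ^ 2 + 2 * t + 3) ^ (3 / 2 : ℝ)
    + 3 * (t - 3) / (3 * t ^ 2 - 2 * t + 3) ^ (3 / 2 : ℝ)
    - (√3 * t - √3) / (3 * (t - 1) ^ 3)

/-- Denominator in the formula for the mass ratio. -/
def cubeRatioDen (t : ℝ) : ℝ :=
  24 * cubeC t - 1 / 12 * √3 - 3 / 8 * √2 - 3 / 4

end

/-!
Reflections in the coordinate hyperplanes and permutations of the axes make the force of one cube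
on a vertex of a concentric one radial. Hence the sixteen vertices form a central configuration if
and only if some `lam` satisfies the two scalar equations `lam = μ₁ * A + μ₂ * B` and
`lam * t = μ₁ * C + μ₂ * D`, in which `A` and `D` are the pulls of the outer and the inner cube on
themselves, `B` is that of the inner cube on the outer one and `C` that of the outer on the inner.

With `lam = l * (μ₁ + μ₂)` these become a homogeneous linear system for the masses whose
determinant is affine in `l`: a nonzero solution forces
`l * (A * t + D - B * t - C) = A * D - B * C`, and the first equation gives
`μ₁ / μ₂ = -(l - B) / (l - A)`. Here `γ₀ = 9 * (A * D - B * C)`,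
`γ₁ = -72 * (A * t + D - B * t - C)` and `l = 8 * c`, so the sign claims become inequalities
between pulls. In these the mixed distances are estimated by `r ^ 3 ≥ 3 * r ^ 2 - 4`.
-/

section CentralConfiguration

variable {κ E : Type*} [Fintype κ] [NormedAddCommGroup E] [NormedSpace ℝ E]

theorem centerOfMass_add_eq {m : κ → ℝ} {v : κ → E} (hm : ∑ j, m j ≠ 0)
    (hv : ∑ j, m j • v j = 0) (o : E) : centerOfMass m (fun j => o + v j) = o := by
  simp only [centerOfMass, smul_add, Finset.sum_add_distrib, hv, add_zero, ← Finset.sum_smul,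
    inv_smul_smul₀ hm]

theorem isCentralConfiguration_add_iff [DecidableEq κ] {m : κ → ℝ} {v : κ → E}
    (hm : ∑ j, m j ≠ 0) (hv : ∑ j, m j • v j = 0) (o : E) :
    IsCentralConfiguration m (fun j => o + v j) ↔
      ∃ lam : ℝ, ∀ i, -lam • v i = ∑ j, (m j / ‖v j - v i‖ ^ 3) • (v j - v i) := by
  simp only [IsCentralConfiguration, centerOfMass_add_eq hm hv, add_sub_cancel_left,
    add_sub_add_left_eq_sub]
  refine exists_congr fun lam => forall_congr' fun i => ?_
  rw [Finset.sum_erase _ (by rw [sub_self, smul_zero])]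

end CentralConfiguration

section Signs

/-- The sign `±1` of a Boolean, with `true` positive as in `cubeVertex`. -/
noncomputable def boolSign (b : Bool) : ℝ := if b then 1 else -1

theorem boolSign_true : boolSign true = 1 := rfl

theorem boolSign_false : boolSign false = -1 := rfl

theorem boolSign_beq (b c : Bool) : boolSign (b == c) = boolSign b * boolSign c := by
  cases b <;> cases c <;> norm_num [boolSign]

theorem boolSign_sq (b : Bool) : boolSign b ^ 2 = 1 := by
  cases b <;> norm_num [boolSign]

variable {ι : Type*}

/-- Componentwise product of labels, when Booleans are read as signs. Multiplying by a fixed label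
is an involution; geometrically it is a reflection of the hypercube moving any given vertex to the
all-positive one. -/
def mulLabel (i : ι → Bool) : Equiv.Perm (ι → Bool) :=
  Function.Involutive.toPerm (fun s k => i k == s k) fun s => by
    funext k
    cases i k <;> simp

theorem boolSign_mulLabel (i s : ι → Bool) (k : ι) :
    boolSign (mulLabel i s k) = boolSign (i k) * boolSign (s k) :=
  boolSign_beq _ _

variable [Fintype ι]

/-- The number of positive signs of a label. -/
def positiveCount (s : ι → Bool) : ℕ := (Finset.univ.filter fun k => s k = true).card

theorem positiveCount_comp_perm (s : ι → Bool) (σ : Equiv.Perm ι) :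
    positiveCount (s ∘ σ) = positiveCount s := by
  rw [positiveCount, positiveCount, Finset.card_filter, Finset.card_filter]
  exact Equiv.sum_comp σ fun k => if s k = true then 1 else 0

theorem sum_apply_label (f : Bool → ℝ) (s : ι → Bool) :
    ∑ k, f (s k) =
      positiveCount s * f true + (Fintype.card ι - positiveCount s) * f false := by
  have split_value (b : Bool) :
      f b = (if b = true then 1 else 0) * (f true - f false) + f false := by
    cases b <;> simp
  simp only [split_value (s _), Finset.sum_add_distrib, ← Finset.sum_mul, Finset.sum_boole,
    Finset.sum_const, Finset.card_univ, nsmul_eq_mul, positiveCount]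
  ring

theorem sum_apply_positiveCount [DecidableEq ι] (f : ℕ → ℝ) :
    ∑ s : ι → Bool, f (positiveCount s) =
      ∑ c ∈ Finset.range (Fintype.card ι + 1), (Fintype.card ι).choose c * f c := by
  simp only [← nsmul_eq_mul]
  rw [← Finset.card_univ, ← Finset.sum_powerset_apply_card]
  refine Finset.sum_nbij' (fun s => Finset.univ.filter fun k => s k = true)
    (fun A k => decide (k ∈ A)) ?_ ?_ ?_ ?_ ?_ <;> simp [positiveCount]

/-- By permuting the axes, the left-hand sum does not depend on `k`, so it can be averaged. -/
theorem card_mul_sum_apply_positiveCount_mul [DecidableEq ι] (w : ℕ → ℝ) (f : Bool → ℝ) (k : ι) :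
    Fintype.card ι * ∑ s : ι → Bool, w (positiveCount s) * f (s k) =
      ∑ c ∈ Finset.range (Fintype.card ι + 1), (Fintype.card ι).choose c *
        (w c * (c * f true + (Fintype.card ι - c) * f false)) := by
  have swap_axes (l : ι) : ∑ s : ι → Bool, w (positiveCount s) * f (s k) =
      ∑ s : ι → Bool, w (positiveCount s) * f (s l) := by
    rw [← ((Equiv.swap k l).arrowCongr (Equiv.refl Bool)).sum_comp]
    refine Finset.sum_congr rfl fun s _ => ?_
    have h : (Equiv.swap k l).arrowCongr (Equiv.refl Bool) s = s ∘ Equiv.swap k l := rfl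
    rw [h, positiveCount_comp_perm, Function.comp_apply, Equiv.swap_apply_left]
  calc Fintype.card ι * ∑ s : ι → Bool, w (positiveCount s) * f (s k)
      = ∑ _l : ι, ∑ s : ι → Bool, w (positiveCount s) * f (s k) := by
        rw [Finset.sum_const, Finset.card_univ, nsmul_eq_mul]
    _ = ∑ s : ι → Bool, w (positiveCount s) * ∑ l, f (s l) := by
        rw [Finset.sum_congr rfl fun l _ => swap_axes l, Finset.sum_comm]
        simp only [Finset.mul_sum]
    _ = _ := by
        simp only [sum_apply_label]
        exact sum_apply_positiveCount fun c =>
          w c * (c * f true + (Fintype.card ι - c) * f false)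

end Signs

/-- The inward component of the force on a vertex of the hypercube of half-edge `q` in dimension `n`
exerted by unit masses at the vertices of the concentric hypercube of half-edge `p`, when the force
between two points at distance `r` is `φ r` times their difference. The component is measured in
units of the vertex `(1, …, 1)`, and `c` counts the coordinates in which the attracting vertex has
the same sign as the attracted one. For `p = q` the summand `c = n`, that of the attracted vertex
itself, vanishes. -/
noncomputable def hypercubePull (n : ℕ) (φ : ℝ → ℝ) (p q : ℝ) : ℝ :=
  (∑ c ∈ Finset.range (n + 1), n.choose c *
    (φ √(c * (p - q) ^ 2 + (n - c) * (p + q) ^ 2) *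
      ((n - c) * (p + q) - c * (p - q)))) / n

/-- `hypercubePull` for Newton's law of attraction. -/
noncomputable def newtonPull (n : ℕ) (p q : ℝ) : ℝ := hypercubePull n (fun r => (r ^ 3)⁻¹) p q

theorem newtonPull_mul (n : ℕ) {h : ℝ} (hh : 0 < h) (p q : ℝ) :
    newtonPull n (h * p) (h * q) = newtonPull n p q / h ^ 2 := by
  rw [newtonPull, newtonPull, hypercubePull, hypercubePull, div_right_comm,
    Finset.sum_div _ _ (h ^ 2)]
  congr 1
  refine Finset.sum_congr rfl fun c _ => ?_
  have scale_sq : c * (h * p - h * q) ^ 2 + (n - c) * (h * p + h * q) ^ 2 =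
      h ^ 2 * (c * (p - q) ^ 2 + (n - c) * (p + q) ^ 2) := by ring
  rw [scale_sq, Real.sqrt_mul (sq_nonneg h), Real.sqrt_sq hh.le]
  field_simp

section SignDiagonal

variable {ι E : Type*} [Fintype ι] [AddCommGroup E] [Module ℝ E]

/-- The vertex with label `s` of the hypercube of half-edge `1` centred at the origin with axes
`e`. -/
noncomputable def signDiagonal (e : ι → E) (s : ι → Bool) : E := ∑ k, boolSign (s k) • e k

theorem sum_signDiagonal [DecidableEq ι] (e : ι → E) : ∑ s, signDiagonal e s = 0 := by
  have antipode (s : ι → Bool) :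
      signDiagonal e (mulLabel (fun _ => false) s) = -signDiagonal e s := by
    simp only [signDiagonal, boolSign_mulLabel, boolSign_false, neg_one_mul, neg_smul,
      Finset.sum_neg_distrib]
  have := IsAddTorsionFree.of_isTorsionFree ℝ E
  rw [← self_eq_neg, ← Finset.sum_neg_distrib]
  simp only [← antipode]
  exact (Equiv.sum_comp (mulLabel fun _ => false) (signDiagonal e)).symm

theorem smul_signDiagonal_mulLabel_sub (e : ι → E) (p q : ℝ) (i s : ι → Bool) :
    p • signDiagonal e (mulLabel i s) - q • signDiagonal e i =
      ∑ k, (boolSign (i k) * (p * boolSign (s k) - q)) • e k := by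
  simp only [signDiagonal, Finset.smul_sum, smul_smul, ← Finset.sum_sub_distrib, ← sub_smul,
    boolSign_mulLabel]
  refine Finset.sum_congr rfl fun k _ => ?_
  ring_nf

end SignDiagonal

section OrthonormalAxes

variable {ι E : Type*} [Fintype ι] [NormedAddCommGroup E] [InnerProductSpace ℝ E] {e : ι → E}

theorem norm_sum_smul_of_orthonormal (he : Orthonormal ℝ e) (c : ι → ℝ) :
    ‖∑ k, c k • e k‖ = √(∑ k, c k ^ 2) := by
  rw [norm_eq_sqrt_real_inner, he.inner_sum]
  simp only [conj_trivial, pow_two]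

theorem signDiagonal_ne_zero [Nonempty ι] (he : Orthonormal ℝ e) (s : ι → Bool) :
    signDiagonal e s ≠ 0 := by
  rw [← norm_pos_iff, signDiagonal, norm_sum_smul_of_orthonormal he, Real.sqrt_pos]
  simp [boolSign_sq, Fintype.card_pos]

theorem norm_smul_signDiagonal_mulLabel_sub (he : Orthonormal ℝ e) (p q : ℝ) (i s : ι → Bool) :
    ‖p • signDiagonal e (mulLabel i s) - q • signDiagonal e i‖ =
      √(positiveCount s * (p - q) ^ 2 + (Fintype.card ι - positiveCount s) * (p + q) ^ 2) := by
  rw [smul_signDiagonal_mulLabel_sub, norm_sum_smul_of_orthonormal he]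
  simp only [mul_pow, boolSign_sq, one_mul]
  rw [sum_apply_label fun b => (p * boolSign b - q) ^ 2]
  simp only [boolSign_true, boolSign_false]
  ring_nf

theorem sum_smul_sub_signDiagonal [DecidableEq ι] (he : Orthonormal ℝ e) (φ : ℝ → ℝ) (p q : ℝ)
    (i : ι → Bool) :
    ∑ s, φ ‖p • signDiagonal e s - q • signDiagonal e i‖ •
        (p • signDiagonal e s - q • signDiagonal e i) =
      -hypercubePull (Fintype.card ι) φ p q • signDiagonal e i := by
  have coefficient (k : ι) :
      ∑ s : ι → Bool, φ √(positiveCount s * (p - q) ^ 2 +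
          (Fintype.card ι - positiveCount s) * (p + q) ^ 2) * (p * boolSign (s k) - q) =
        -hypercubePull (Fintype.card ι) φ p q := by
    have hn : (Fintype.card ι : ℝ) ≠ 0 := Nat.cast_ne_zero.2 (Fintype.card_pos_iff.2 ⟨k⟩).ne'
    rw [hypercubePull, ← neg_div, eq_div_iff hn, mul_comm]
    refine (card_mul_sum_apply_positiveCount_mul
      (fun c => φ √(c * (p - q) ^ 2 + (Fintype.card ι - c) * (p + q) ^ 2))
      (fun b => p * boolSign b - q) k).trans ?_
    rw [← Finset.sum_neg_distrib]
    refine Finset.sum_congr rfl fun c _ => ?_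
    simp only [boolSign_true, boolSign_false]
    ring
  rw [← Equiv.sum_comp (mulLabel i)]
  simp only [norm_smul_signDiagonal_mulLabel_sub he]
  simp only [smul_signDiagonal_mulLabel_sub, Finset.smul_sum, smul_smul]
  rw [Finset.sum_comm, signDiagonal, Finset.smul_sum]
  refine Finset.sum_congr rfl fun k _ => ?_
  rw [← Finset.sum_smul, smul_smul, ← coefficient k, Finset.sum_mul]
  congr 1
  refine Finset.sum_congr rfl fun s _ => ?_
  ring

theorem sum_newton_signDiagonal [DecidableEq ι] (he : Orthonormal ℝ e) (m p q : ℝ)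
    (i : ι → Bool) :
    ∑ s, (m / ‖p • signDiagonal e s - q • signDiagonal e i‖ ^ 3) •
        (p • signDiagonal e s - q • signDiagonal e i) =
      -(m * newtonPull (Fintype.card ι) p q) • signDiagonal e i := by
  simp only [div_eq_mul_inv, mul_smul, ← Finset.smul_sum, neg_mul_eq_mul_neg]
  rw [sum_smul_sub_signDiagonal he fun r => (r ^ 3)⁻¹, newtonPull]

theorem isCentralConfiguration_concentric_iff [DecidableEq ι] [Nonempty ι] (he : Orthonormal ℝ e)
    {μ₁ μ₂ : ℝ} (hM : μ₁ + μ₂ ≠ 0) (o : E) (p q : ℝ) :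
    IsCentralConfiguration
        (Sum.elim (fun _ => μ₁) fun _ => μ₂ : (ι → Bool) ⊕ (ι → Bool) → ℝ)
        (fun j => o + Sum.elim (p • signDiagonal e ·) (q • signDiagonal e ·) j) ↔
      ∃ lam : ℝ,
        lam * p =
          μ₁ * newtonPull (Fintype.card ι) p p + μ₂ * newtonPull (Fintype.card ι) q p ∧
        lam * q =
          μ₁ * newtonPull (Fintype.card ι) p q + μ₂ * newtonPull (Fintype.card ι) q q := by
  have total_mass :
      ∑ j : (ι → Bool) ⊕ (ι → Bool), (Sum.elim (fun _ => μ₁) fun _ => μ₂ : _ → ℝ) j ≠ 0 := by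
    simpa [← mul_add] using hM
  have balanced : ∑ j, (Sum.elim (fun _ => μ₁) fun _ => μ₂ : (ι → Bool) ⊕ (ι → Bool) → ℝ) j •
      Sum.elim (p • signDiagonal e ·) (q • signDiagonal e ·) j = 0 := by
    simp [← Finset.smul_sum, sum_signDiagonal]
  have cancel (x y : ℝ) (i : ι → Bool) :
      x • signDiagonal e i = y • signDiagonal e i ↔ x = y :=
    (smul_left_injective ℝ (signDiagonal_ne_zero he i)).eq_iff
  rw [isCentralConfiguration_add_iff total_mass balanced]
  simp only [Fintype.sum_sum_type, Sum.forall, Sum.elim_inl, Sum.elim_inr,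
    sum_newton_signDiagonal he, smul_smul, ← add_smul, cancel, forall_const, ← neg_add, neg_mul,
    neg_inj]

end OrthonormalAxes

theorem nestedCubes_eq (o : EuclideanSpace ℝ (Fin 3))
    (e : OrthonormalBasis (Fin 3) ℝ (EuclideanSpace ℝ (Fin 3))) (a t : ℝ) :
    nestedCubes o e a t =
      fun j => o + Sum.elim ((a / 2) • signDiagonal e ·) ((a / 2 * t) • signDiagonal e ·) j := by
  have cubeVertex_eq (b : ℝ) (s : CubeLabel) :
      cubeVertex o e b s = o + (b / 2) • signDiagonal e s := by
    simp only [cubeVertex, signDiagonal, boolSign, Finset.smul_sum, smul_smul, mul_ite, mul_one,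
      mul_neg]
  funext j
  rcases j with s | s
  · exact cubeVertex_eq a s
  · exact (cubeVertex_eq (t * a) s).trans (by rw [Sum.elim_inr, mul_comm t, mul_div_right_comm])

theorem isCentralConfiguration_nestedCubes_iff (o : EuclideanSpace ℝ (Fin 3))
    (e : OrthonormalBasis (Fin 3) ℝ (EuclideanSpace ℝ (Fin 3))) {a t μ₁ μ₂ : ℝ} (ha : 0 < a)
    (hM : μ₁ + μ₂ ≠ 0) :
    IsCentralConfiguration (nestedCubesMass μ₁ μ₂) (nestedCubes o e a t) ↔
      ∃ lam : ℝ, lam = μ₁ * newtonPull 3 1 1 + μ₂ * newtonPull 3 t 1 ∧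
        lam * t = μ₁ * newtonPull 3 1 t + μ₂ * newtonPull 3 t t := by
  have hh : 0 < a / 2 := half_pos ha
  have rescale (p q : ℝ) := newtonPull_mul 3 hh p q
  rw [nestedCubes_eq, nestedCubesMass, isCentralConfiguration_concentric_iff e.orthonormal hM,
    Fintype.card_fin]
  have rescale_one := rescale 1 1
  have rescale_left := rescale t 1
  have rescale_right := rescale 1 t
  rw [mul_one] at rescale_one rescale_left rescale_right
  rw [rescale_one, rescale_left, rescale_right, rescale t t]
  have scale_equation (lam x A B : ℝ) :
      lam * (a / 2 * x) = μ₁ * (A / (a / 2) ^ 2) + μ₂ * (B / (a / 2) ^ 2) ↔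
        lam * (a / 2) ^ 3 * x = μ₁ * A + μ₂ * B := by
    rw [← mul_div_assoc, ← mul_div_assoc, ← add_div, eq_div_iff (by positivity)]
    ring_nf
  have scale_one (lam A B : ℝ) := scale_equation lam 1 A B
  simp only [mul_one] at scale_one
  simp only [scale_one, scale_equation]
  exact ((mul_right_surjective₀ (pow_ne_zero 3 hh.ne')).exists (p := fun lam =>
    lam = μ₁ * newtonPull 3 1 1 + μ₂ * newtonPull 3 t 1 ∧
      lam * t = μ₁ * newtonPull 3 1 t + μ₂ * newtonPull 3 t t)).symm

/-- The reciprocal cubed distance between the vertex `(1, 1, 1)` of the cube of half-edge `1` and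
the vertex `(t, -t, -t)` of the cube of half-edge `t`. Its value at `-t` is that for `(t, t, -t)`,
which is why both signs of `t` occur below. -/
noncomputable def crossKernel (t : ℝ) : ℝ := (√(3 * t ^ 2 + 2 * t + 3) ^ 3)⁻¹

theorem crossKernel_radicand_pos (t : ℝ) : 0 < 3 * t ^ 2 + 2 * t + 3 := by
  nlinarith [sq_nonneg (t + 1)]

theorem crossKernel_neg (t : ℝ) : crossKernel (-t) = (√(3 * t ^ 2 - 2 * t + 3) ^ 3)⁻¹ := by
  rw [crossKernel]
  ring_nf

theorem rpow_eq_inv_crossKernel (t : ℝ) :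
    (3 * t ^ 2 + 2 * t + 3) ^ (3 / 2 : ℝ) = (crossKernel t)⁻¹ := by
  rw [crossKernel, inv_inv, Real.rpow_div_two_eq_sqrt _ (crossKernel_radicand_pos t).le]
  exact_mod_cast Real.rpow_natCast _ 3

theorem rpow_eq_inv_crossKernel_neg (t : ℝ) :
    (3 * t ^ 2 - 2 * t + 3) ^ (3 / 2 : ℝ) = (crossKernel (-t))⁻¹ := by
  rw [← rpow_eq_inv_crossKernel]
  ring_nf

theorem inv_pow_three_eq_crossKernel_sq (t : ℝ) :
    ((3 * t ^ 2 + 2 * t + 3) ^ 3)⁻¹ = crossKernel t ^ 2 := by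
  rw [crossKernel, inv_pow, ← pow_mul, mul_comm 3 2, pow_mul,
    Real.sq_sqrt (crossKernel_radicand_pos t).le]

theorem inv_pow_three_eq_crossKernel_neg_sq (t : ℝ) :
    ((3 * t ^ 2 - 2 * t + 3) ^ 3)⁻¹ = crossKernel (-t) ^ 2 := by
  rw [← inv_pow_three_eq_crossKernel_sq]
  ring_nf

/-- The left-hand side is the tangent line of `x ^ (3 / 2)` at `x = 4`. -/
theorem three_mul_sub_four_le_sqrt_pow_three {x : ℝ} (hx : 0 ≤ x) : 3 * x - 4 ≤ √x ^ 3 := by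
  have factored : √x ^ 3 - (3 * √x ^ 2 - 4) = (√x - 2) ^ 2 * (√x + 1) := by ring
  rw [Real.sq_sqrt hx] at factored
  exact sub_nonneg.1 (factored ▸ by positivity)

theorem crossKernel_le (t : ℝ) : crossKernel t ≤ (9 * t ^ 2 + 6 * t + 5)⁻¹ := by
  refine inv_anti₀ (by nlinarith [sq_nonneg (t + 1)]) ?_
  linarith [three_mul_sub_four_le_sqrt_pow_three (crossKernel_radicand_pos t).le]

theorem crossKernel_add_neg_le (t : ℝ) : crossKernel t + crossKernel (-t) ≤ 2 / 5 := by
  have hp : 0 < 9 * t ^ 2 + 6 * t + 5 := by nlinarith [sq_nonneg (t + 1)]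
  have hm : 0 < 9 * (-t) ^ 2 + 6 * -t + 5 := by nlinarith [sq_nonneg (t - 1)]
  calc crossKernel t + crossKernel (-t)
      ≤ (9 * t ^ 2 + 6 * t + 5)⁻¹ + (9 * (-t) ^ 2 + 6 * -t + 5)⁻¹ :=
        add_le_add (crossKernel_le t) (crossKernel_le (-t))
    _ ≤ 2 / 5 := by
        rw [inv_add_inv hp.ne' hm.ne', div_le_div_iff₀ (by positivity) (by norm_num)]
        nlinarith [sq_nonneg t, sq_nonneg (t ^ 2)]

theorem crossKernel_le_neg {t : ℝ} (ht : 0 ≤ t) : crossKernel t ≤ crossKernel (-t) := by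
  have := crossKernel_radicand_pos (-t)
  rw [crossKernel, crossKernel]
  gcongr ?_⁻¹
  gcongr √?_ ^ 3
  nlinarith

theorem inv_pow_three_le_crossKernel {t r : ℝ} (hr : 0 ≤ r)
    (h : 3 * t ^ 2 + 2 * t + 3 ≤ r ^ 2) : (r ^ 3)⁻¹ ≤ crossKernel t := by
  have := crossKernel_radicand_pos t
  rw [crossKernel]
  gcongr
  exact Real.sqrt_le_iff.2 ⟨hr, h⟩

theorem newtonPull_three (p q : ℝ) :
    newtonPull 3 p q = (p + q) / √(3 * (p + q) ^ 2) ^ 3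
      + (p + 3 * q) / √((p - q) ^ 2 + 2 * (p + q) ^ 2) ^ 3
      + (3 * q - p) / √(2 * (p - q) ^ 2 + (p + q) ^ 2) ^ 3
      + (q - p) / √(3 * (p - q) ^ 2) ^ 3 := by
  norm_num [newtonPull, hypercubePull, Finset.sum_range_succ, Nat.choose]
  ring

theorem sqrt_pow_four {x : ℝ} (hx : 0 ≤ x) : √x ^ 4 = x ^ 2 := by
  rw [pow_mul √x 2 2, Real.sq_sqrt hx]

theorem div_sqrt_three_mul_sq_pow_three {y : ℝ} (hy : 0 < y) :
    y / √(3 * y ^ 2) ^ 3 = √3 / 9 / y ^ 2 := by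
  rw [Real.sqrt_mul (by norm_num), Real.sqrt_sq hy.le]
  field_simp
  rw [sqrt_pow_four (by norm_num)]
  norm_num

theorem newtonPull_three_one_one : newtonPull 3 1 1 = 1 / 4 + √2 / 8 + √3 / 36 := by
  have sqrt_four : √(4 : ℝ) = 2 := by
    rw [show (4 : ℝ) = 2 ^ 2 by norm_num, Real.sqrt_sq (by norm_num)]
  have sqrt_eight : √(8 : ℝ) = 2 * √2 := by
    rw [show (8 : ℝ) = 4 * 2 by norm_num, Real.sqrt_mul (by norm_num), sqrt_four]
  have face : 4 / √(8 : ℝ) ^ 3 = √2 / 8 := by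
    rw [sqrt_eight]
    field_simp
    rw [sqrt_pow_four (by norm_num)]
    norm_num
  have space := div_sqrt_three_mul_sq_pow_three (y := 1 + 1) (by norm_num)
  rw [newtonPull_three, space]
  norm_num [face, sqrt_four]
  ring

theorem newtonPull_self (n : ℕ) {t : ℝ} (ht : 0 < t) :
    newtonPull n t t = newtonPull n 1 1 / t ^ 2 := by
  rw [← newtonPull_mul n ht, mul_one]

theorem newtonPull_three_left_one {t : ℝ} (ht : |t| < 1) :
    newtonPull 3 t 1 = √3 / 9 * (1 / (1 + t) ^ 2 + 1 / (1 - t) ^ 2)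
      + (3 + t) * crossKernel t + (3 - t) * crossKernel (-t) := by
  obtain ⟨h_neg, h_pos⟩ := abs_lt.1 ht
  have radicand_add : (1 - t) ^ 2 + 2 * (1 + t) ^ 2 = 3 * t ^ 2 + 2 * t + 3 := by ring
  have radicand_sub : 2 * (1 - t) ^ 2 + (1 + t) ^ 2 = 3 * t ^ 2 - 2 * t + 3 := by ring
  rw [newtonPull_three, add_comm t 1, sub_sq_comm, radicand_add, radicand_sub,
    div_sqrt_three_mul_sq_pow_three (by linarith : 0 < 1 + t),
    div_sqrt_three_mul_sq_pow_three (by linarith : 0 < 1 - t), crossKernel_neg, crossKernel]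
  ring

theorem newtonPull_three_right_one {t : ℝ} (ht : |t| < 1) :
    newtonPull 3 1 t = √3 / 9 * (1 / (1 + t) ^ 2 - 1 / (1 - t) ^ 2)
      + (1 + 3 * t) * crossKernel t - (1 - 3 * t) * crossKernel (-t) := by
  obtain ⟨h_neg, h_pos⟩ := abs_lt.1 ht
  have radicand_add : (1 - t) ^ 2 + 2 * (1 + t) ^ 2 = 3 * t ^ 2 + 2 * t + 3 := by ring
  have radicand_sub : 2 * (1 - t) ^ 2 + (1 + t) ^ 2 = 3 * t ^ 2 - 2 * t + 3 := by ring
  rw [newtonPull_three, ← neg_sub 1 t, neg_div, radicand_add, radicand_sub,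
    div_sqrt_three_mul_sq_pow_three (by linarith : 0 < 1 + t),
    div_sqrt_three_mul_sq_pow_three (by linarith : 0 < 1 - t), crossKernel_neg, crossKernel]
  ring

section PullBounds

theorem sqrt_two_gt : 7 / 5 < √2 := Real.lt_sqrt_of_sq_lt (by norm_num)

theorem sqrt_three_gt : 17 / 10 < √3 := Real.lt_sqrt_of_sq_lt (by norm_num)

theorem sqrt_three_lt : √3 < 9 / 5 := (Real.sqrt_lt' (by norm_num)).2 (by norm_num)

theorem newtonPull_three_one_one_gt : 47 / 100 < newtonPull 3 1 1 := by
  rw [newtonPull_three_one_one]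
  linarith [sqrt_two_gt, sqrt_three_gt]

theorem newtonPull_three_one_one_lt : newtonPull 3 1 1 < 1 / 2 := by
  rw [newtonPull_three_one_one]
  linarith [Real.sqrt_two_lt_three_halves, sqrt_three_lt]

variable {t : ℝ}

theorem half_lt_newtonPull_three_left_one (ht₀ : 0 ≤ t) (ht₁ : t < 1) :
    1 / 2 < newtonPull 3 t 1 := by
  have far : (3 ^ 3 : ℝ)⁻¹ ≤ crossKernel t :=
    inv_pow_three_le_crossKernel (by norm_num) (by nlinarith)
  have near : (2 ^ 3 : ℝ)⁻¹ ≤ crossKernel (-t) :=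
    inv_pow_three_le_crossKernel (by norm_num) (by nlinarith)
  have nearest : 1 ≤ 1 / (1 - t) ^ 2 :=
    (one_le_div (by nlinarith)).2 (by nlinarith)
  have farthest : 0 ≤ 1 / (1 + t) ^ 2 := by positivity
  rw [newtonPull_three_left_one (abs_lt.2 ⟨by linarith, ht₁⟩)]
  nlinarith [sqrt_three_gt]

theorem newtonPull_three_left_one_le (ht₀ : 0 ≤ t) (ht : t ≤ 1 / 2) :
    newtonPull 3 t 1 ≤ 11 / 5 := by
  have nearest : 1 / (1 - t) ^ 2 ≤ 4 := by
    rw [div_le_iff₀ (by nlinarith)]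
    nlinarith
  have farthest : 1 / (1 + t) ^ 2 ≤ 1 := (div_le_one (by positivity)).2 (by nlinarith)
  have cross : (3 + t) * crossKernel t + (3 - t) * crossKernel (-t) ≤ 6 / 5 := by
    nlinarith [crossKernel_add_neg_le t, crossKernel_le_neg ht₀]
  rw [newtonPull_three_left_one (abs_lt.2 ⟨by linarith, by linarith⟩)]
  nlinarith [sqrt_three_lt, Real.sqrt_nonneg 3]

theorem newtonPull_three_right_one_le (ht₀ : 0 ≤ t) (ht₁ : t < 1) :
    newtonPull 3 1 t ≤ t * (6 / 5 - 34 / 45 / (1 - t ^ 2) ^ 2) := by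
  have h_minus : 0 < 1 - t := by linarith
  have diagonal : 1 / (1 + t) ^ 2 - 1 / (1 - t) ^ 2 = -(4 * t / (1 - t ^ 2) ^ 2) := by
    rw [show 1 - t ^ 2 = (1 + t) * (1 - t) by ring]
    field_simp
    ring
  have diagonal_le : √3 / 9 * -(4 * t / (1 - t ^ 2) ^ 2) ≤
      17 / 90 * -(4 * t / (1 - t ^ 2) ^ 2) :=
    mul_le_mul_of_nonpos_right (by linarith [sqrt_three_gt]) (neg_nonpos.2 (by positivity))
  have cross : (1 + 3 * t) * crossKernel t - (1 - 3 * t) * crossKernel (-t) ≤ t * (6 / 5) := by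
    nlinarith [crossKernel_add_neg_le t, crossKernel_le_neg ht₀]
  rw [newtonPull_three_right_one (abs_lt.2 ⟨by linarith, ht₁⟩), diagonal]
  linear_combination diagonal_le + cross

theorem newtonPull_three_right_one_lt_mul (ht₀ : 0 < t) (ht₁ : t < 1) :
    newtonPull 3 1 t < newtonPull 3 1 1 * t := by
  have h_sq : 0 < 1 - t ^ 2 := by nlinarith
  have h : 34 / 45 ≤ 34 / 45 / (1 - t ^ 2) ^ 2 :=
    le_div_self (by norm_num) (by positivity) (by nlinarith)
  calc newtonPull 3 1 t ≤ t * (6 / 5 - 34 / 45 / (1 - t ^ 2) ^ 2) :=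
        newtonPull_three_right_one_le ht₀.le ht₁
    _ ≤ t * (6 / 5 - 34 / 45) := by gcongr
    _ < t * newtonPull 3 1 1 := by
        gcongr
        linarith [newtonPull_three_one_one_gt]
    _ = newtonPull 3 1 1 * t := mul_comm _ _

theorem newtonPull_three_right_one_nonpos (ht : 1 / 2 ≤ t) (ht₁ : t < 1) :
    newtonPull 3 1 t ≤ 0 := by
  have h_sq : 0 < 1 - t ^ 2 := by nlinarith
  have h : 6 / 5 ≤ 34 / 45 / (1 - t ^ 2) ^ 2 := by
    have h_le : 1 - t ^ 2 ≤ 3 / 4 := by nlinarith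
    rw [le_div_iff₀ (by positivity)]
    nlinarith
  exact (newtonPull_three_right_one_le (by linarith) ht₁).trans
    (mul_nonpos_of_nonneg_of_nonpos (by linarith) (by linarith))

theorem newtonPull_three_mul_lt_mul (ht₀ : 0 < t) (ht₁ : t < 1) :
    newtonPull 3 t 1 * newtonPull 3 1 t < newtonPull 3 1 1 * newtonPull 3 t t := by
  have h_self := newtonPull_three_one_one_gt
  have h_inner := half_lt_newtonPull_three_left_one ht₀.le ht₁
  rw [newtonPull_self 3 ht₀]
  rcases le_total (1 / 2) t with h | h
  · calc newtonPull 3 t 1 * newtonPull 3 1 t ≤ 0 :=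
          mul_nonpos_of_nonneg_of_nonpos (by linarith) (newtonPull_three_right_one_nonpos h ht₁)
      _ < newtonPull 3 1 1 * (newtonPull 3 1 1 / t ^ 2) := by positivity
  · have h_cube : t ^ 3 ≤ (1 / 2) ^ 3 := by gcongr
    calc newtonPull 3 t 1 * newtonPull 3 1 t
        ≤ newtonPull 3 t 1 * (newtonPull 3 1 1 * t) :=
          mul_le_mul_of_nonneg_left (newtonPull_three_right_one_lt_mul ht₀ ht₁).le (by linarith)
      _ ≤ 11 / 5 * (newtonPull 3 1 1 * t) :=
          mul_le_mul_of_nonneg_right (newtonPull_three_left_one_le ht₀.le h) (by positivity)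
      _ < newtonPull 3 1 1 * (newtonPull 3 1 1 / t ^ 2) := by
          rw [← mul_div_assoc, lt_div_iff₀ (by positivity)]
          nlinarith

/-- The two sides are closest near `7 / 9`, where the difference is less than `1 / 50`. -/
theorem mul_lt_div_sq_add_div_one_sub_sq (ht₀ : 0 < t) (ht₁ : t < 1) :
    193 / 100 * t < 47 / 100 / t ^ 2 + 17 / 45 * t / (1 - t ^ 2) := by
  have h_sq : 0 < 1 - t ^ 2 := by nlinarith
  rw [div_add_div _ _ (by positivity) h_sq.ne', lt_div_iff₀ (by positivity)]
  have h_double_root := sq_nonneg (9 * t - 7)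
  nlinarith [mul_nonneg (pow_nonneg ht₀.le 3) h_double_root,
    mul_nonneg (pow_nonneg ht₀.le 2) h_double_root, mul_nonneg ht₀.le h_double_root]

theorem newtonPull_three_cross_lt_self (ht₀ : 0 < t) (ht₁ : t < 1) :
    newtonPull 3 t 1 * t + newtonPull 3 1 t < newtonPull 3 1 1 * t + newtonPull 3 t t := by
  have h_minus : 0 < 1 - t := by linarith
  have h_sq : 0 < 1 - t ^ 2 := by nlinarith
  have diagonal : √3 / 9 * (1 / (1 + t) ^ 2 + 1 / (1 - t) ^ 2) * t +
      √3 / 9 * (1 / (1 + t) ^ 2 - 1 / (1 - t) ^ 2) = -(√3 / 9 * (2 * t / (1 - t ^ 2))) := by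
    rw [show 1 - t ^ 2 = (1 + t) * (1 - t) by ring]
    field_simp
    ring
  have diagonal_ge : 17 / 90 * (2 * t / (1 - t ^ 2)) ≤ √3 / 9 * (2 * t / (1 - t ^ 2)) :=
    mul_le_mul_of_nonneg_right (by linarith [sqrt_three_gt]) (by positivity)
  have cross : 6 * t * (crossKernel t + crossKernel (-t)) -
      (1 + t ^ 2) * (crossKernel (-t) - crossKernel t) ≤ 6 * t * (2 / 5) := by
    have h_sum := mul_le_mul_of_nonneg_left (crossKernel_add_neg_le t) (by positivity : 0 ≤ 6 * t)
    have h_diff := mul_nonneg (by positivity : 0 ≤ 1 + t ^ 2)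
      (sub_nonneg.2 (crossKernel_le_neg ht₀.le))
    linarith
  have self_ge : 47 / 100 * t + 47 / 100 / t ^ 2 ≤
      newtonPull 3 1 1 * t + newtonPull 3 1 1 / t ^ 2 := by
    have := newtonPull_three_one_one_gt.le
    gcongr
  have ht : |t| < 1 := abs_lt.2 ⟨by linarith, ht₁⟩
  rw [newtonPull_self 3 ht₀, newtonPull_three_left_one ht, newtonPull_three_right_one ht]
  linear_combination diagonal + diagonal_ge + cross + self_ge +
    mul_lt_div_sq_add_div_one_sub_sq ht₀ ht₁

end PullBounds

section PaperFormulas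

variable {t : ℝ}

theorem cubeGamma₁_eq (ht₀ : 0 < t) (ht₁ : t < 1) :
    cubeGamma₁ t = -72 * (newtonPull 3 1 1 * t + newtonPull 3 t t
      - newtonPull 3 t 1 * t - newtonPull 3 1 t) := by
  have h_plus : 1 + t ≠ 0 := by positivity
  have h_minus : 1 - t ≠ 0 := by linarith
  have ht : |t| < 1 := abs_lt.2 ⟨by linarith, ht₁⟩
  have plus_term : 8 * √3 / (1 + t) = 72 * (√3 / 9 * (1 / (1 + t) ^ 2) * (1 + t)) := by
    field_simp
    ring
  have minus_term : 8 * √3 / (1 - t) = 72 * (√3 / 9 * (1 / (1 - t) ^ 2) * (1 - t)) := by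
    field_simp
    ring
  rw [cubeGamma₁, rpow_eq_inv_crossKernel, rpow_eq_inv_crossKernel_neg, add_comm t 1,
    ← neg_sub 1 t, div_neg, plus_term, minus_term, newtonPull_self 3 ht₀,
    newtonPull_three_one_one, newtonPull_three_left_one ht, newtonPull_three_right_one ht]
  simp only [div_inv_eq_mul]
  ring

theorem cubeGamma₀_eq (ht₀ : 0 < t) (ht₁ : t < 1) :
    cubeGamma₀ t = 9 * (newtonPull 3 1 1 * newtonPull 3 t t
      - newtonPull 3 t 1 * newtonPull 3 1 t) := by
  have h_plus : (1 + t) * (1 + t)⁻¹ = 1 := mul_inv_cancel₀ (by positivity)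
  have h_minus : (1 - t) * (1 - t)⁻¹ = 1 := mul_inv_cancel₀ (by linarith)
  have h_two : √(2 : ℝ) ^ 2 = 2 := Real.sq_sqrt (by norm_num)
  have h_three : √(3 : ℝ) ^ 2 = 3 := Real.sq_sqrt (by norm_num)
  have ht : |t| < 1 := abs_lt.2 ⟨by linarith, ht₁⟩
  rw [cubeGamma₀, rpow_eq_inv_crossKernel, rpow_eq_inv_crossKernel_neg, add_comm t 1,
    ← neg_sub 1 t, newtonPull_self 3 ht₀, newtonPull_three_one_one, newtonPull_three_left_one ht,
    newtonPull_three_right_one ht]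
  simp only [div_eq_mul_inv _ ((_ : ℝ) ^ 3), inv_pow_three_eq_crossKernel_sq,
    inv_pow_three_eq_crossKernel_neg_sq]
  simp only [div_eq_mul_inv, mul_inv, ← inv_pow, inv_neg, inv_inv]
  generalize crossKernel t = X
  generalize crossKernel (-t) = Y
  generalize (1 + t)⁻¹ = U at h_plus ⊢
  generalize (1 - t)⁻¹ = V at h_minus ⊢
  linear_combination (4 * √3 * X * U + 2 * √3 * Y * U) * h_plus
    - (2 * √3 * X * V + 4 * √3 * Y * V) * h_minus + (U ^ 4 - V ^ 4) / 9 * h_three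
    - 9 * (t⁻¹) ^ 2 * (h_two / 64 + h_three / 1296)

theorem cubeRatioNum_eq (ht₀ : 0 < t) (ht₁ : t < 1) :
    cubeRatioNum t = 3 * (8 * cubeC t - newtonPull 3 t 1) := by
  have h_plus : 1 + t ≠ 0 := by positivity
  have h_minus : 1 - t ≠ 0 := by linarith
  have plus_term : (√3 * t + √3) / (3 * (t + 1) ^ 3) = 3 * (√3 / 9 * (1 / (1 + t) ^ 2)) := by
    rw [add_comm t 1]
    field_simp
    ring
  have minus_term : (√3 * t - √3) / (3 * (t - 1) ^ 3) = 3 * (√3 / 9 * (1 / (1 - t) ^ 2)) := by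
    rw [← neg_sub 1 t]
    field_simp
    ring
  rw [cubeRatioNum, rpow_eq_inv_crossKernel, rpow_eq_inv_crossKernel_neg, plus_term, minus_term,
    newtonPull_three_left_one (abs_lt.2 ⟨by linarith, ht₁⟩)]
  simp only [div_inv_eq_mul]
  ring

theorem cubeRatioDen_eq (t : ℝ) : cubeRatioDen t = 3 * (8 * cubeC t - newtonPull 3 1 1) := by
  rw [cubeRatioDen, newtonPull_three_one_one]
  ring

end PaperFormulas

section LinearAlgebra

variable {A B C D t l : ℝ}

theorem multiplier_sub_mul_eq (hl : l * (A * t + D - B * t - C) = A * D - B * C) :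
    (l - A) * (A * t + D - B * t - C) = (B - A) * (A * t - C) ∧
      (l - B) * (A * t + D - B * t - C) = (B - A) * (B * t - D) :=
  ⟨by linear_combination hl, by linear_combination hl⟩

theorem exists_multiplier_iff_div_eq {x y : ℝ} (hy : y ≠ 0) (hlA : l ≠ A)
    (hΔ : A * t + D - B * t - C ≠ 0) (hl : l * (A * t + D - B * t - C) = A * D - B * C) :
    (∃ lam, lam = x * A + y * B ∧ lam * t = x * C + y * D) ↔ x / y = -((l - B) / (l - A)) := by
  obtain ⟨h_den, h_num⟩ := multiplier_sub_mul_eq hl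
  have hBA : B - A ≠ 0 := left_ne_zero_of_mul (h_den ▸ mul_ne_zero (sub_ne_zero.2 hlA) hΔ)
  calc (∃ lam, lam = x * A + y * B ∧ lam * t = x * C + y * D)
      ↔ (x * A + y * B) * t = x * C + y * D := exists_eq_left
    _ ↔ (B - A) * (x * (A * t - C)) = (B - A) * (-(B * t - D) * y) := by
        rw [mul_right_inj' hBA]
        constructor <;> intro h <;> linear_combination h
    _ ↔ x * (l - A) * (A * t + D - B * t - C) = -(l - B) * y * (A * t + D - B * t - C) := by
        constructor <;> intro h
        · linear_combination h + x * h_den + y * h_num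
        · linear_combination h - x * h_den - y * h_num
    _ ↔ x / y = -((l - B) / (l - A)) := by
        rw [mul_left_inj' hΔ, ← neg_div, div_eq_div_iff hy (sub_ne_zero.2 hlA)]

end LinearAlgebra

theorem eight_mul_cubeC_mul {t : ℝ} (ht₀ : 0 < t) (ht₁ : t < 1) :
    8 * cubeC t * (newtonPull 3 1 1 * t + newtonPull 3 t t
      - newtonPull 3 t 1 * t - newtonPull 3 1 t) =
      newtonPull 3 1 1 * newtonPull 3 t t - newtonPull 3 t 1 * newtonPull 3 1 t := by
  have hΔ :
      newtonPull 3 1 1 * t + newtonPull 3 t t - newtonPull 3 t 1 * t - newtonPull 3 1 t ≠ 0 := by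
    linarith [newtonPull_three_cross_lt_self ht₀ ht₁]
  rw [cubeC, cubeGamma₀_eq ht₀ ht₁, cubeGamma₁_eq ht₀ ht₁]
  field_simp
  ring

theorem newtonPull_three_one_one_lt_eight_mul_cubeC {t : ℝ} (ht₀ : 0 < t) (ht₁ : t < 1) :
    newtonPull 3 1 1 < 8 * cubeC t := by
  have h_den := (multiplier_sub_mul_eq (eight_mul_cubeC_mul ht₀ ht₁)).1
  have h_inner : 0 < newtonPull 3 t 1 - newtonPull 3 1 1 := by
    linarith [newtonPull_three_one_one_lt, half_lt_newtonPull_three_left_one ht₀.le ht₁]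
  have h_outer := sub_pos.2 (newtonPull_three_right_one_lt_mul ht₀ ht₁)
  refine sub_pos.1 (pos_of_mul_pos_left (h_den ▸ mul_pos h_inner h_outer) ?_)
  linarith [newtonPull_three_cross_lt_self ht₀ ht₁]

theorem mainTheorem6 (o : EuclideanSpace ℝ (Fin 3))
    (e : OrthonormalBasis (Fin 3) ℝ (EuclideanSpace ℝ (Fin 3)))
    (a t μ₁ μ₂ : ℝ) (ha : 0 < a) (ht₀ : 0 < t) (ht₁ : t < 1)
    (hμ₂ : μ₂ ≠ 0) (hM : μ₁ + μ₂ ≠ 0) :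
    cubeGamma₁ t < 0 ∧ 0 < cubeGamma₀ t ∧ 0 < cubeRatioDen t ∧
      (IsCentralConfiguration (nestedCubesMass μ₁ μ₂) (nestedCubes o e a t) ↔
        μ₁ / μ₂ = -(cubeRatioNum t / cubeRatioDen t)) := by
  have h_cross := newtonPull_three_cross_lt_self ht₀ ht₁
  have h_multiplier := newtonPull_three_one_one_lt_eight_mul_cubeC ht₀ ht₁
  refine ⟨?_, ?_, ?_, ?_⟩
  · rw [cubeGamma₁_eq ht₀ ht₁]
    linarith
  · rw [cubeGamma₀_eq ht₀ ht₁]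
    linarith [newtonPull_three_mul_lt_mul ht₀ ht₁]
  · rw [cubeRatioDen_eq]
    linarith
  · rw [isCentralConfiguration_nestedCubes_iff o e ha hM, cubeRatioNum_eq ht₀ ht₁, cubeRatioDen_eq,
      mul_div_mul_left _ _ three_ne_zero]
    exact exists_multiplier_iff_div_eq hμ₂ h_multiplier.ne' (by linarith)
      (eight_mul_cubeC_mul ht₀ ht₁)
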